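/- Let $X$ be a proper metric space (closed balls are compact) with base point $o$, and let $(x|y)=\frac12\bigl(d(x,o)+d(y,o)-d(x,y)\bigr)$ be the Gromov product. Suppose that $X$ is Gromov-hyperbolic, that is, for some $\delta\ge 0$ one has $(x|z)\ge\min\{(x|y),(y|z)\}-\delta$ for all $x,y,z\in X$. For $A\subseteq X$ let $\partial A$ be the set of sequences $(x_i)$ of $A$ with $(x_i|x_j)\to\infty$ as $i,j\to\infty$, modulo the relation $(x_i)\sim(y_j)$ if $(x_i|y_j)\to\infty$. For $\xi,\eta\in\partial X$ let $(\xi|\eta)$ be the supremum of $\liminf_{i,j\to\infty}(x_i|y_j)$ over the sequences representing $\xi$ and $\eta$, and give $\partial X$ the topology in which the sets $\{\eta\in\partial X : (\eta|\xi)>-\log r\}$, $r>0$, form a basis of neighbourhoods of $\xi$. Suppose that $\partial X$ is compact. For $P\subseteq X$ the critical exponent is $\delta_P=\limsup_{n\to\infty}\frac1n\log\#(B(o,n)\cap P)\in[-\infty,\infty]$, and the entropy is $h_P=\sup_S\delta_{P\cap S}$, where $S$ runs over the separated subsets of $X$ (those for which there is $\varepsilon>0$ with $d(x,y)>\varepsilon$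 for all distinct $x,y\in S$), with $h_\emptyset=0$. For a set $A$ of isometries of $X$ put $Ao=\{\gamma o:\gamma\in A\}$ and $h_A=h_{Ao}$. The set $A$ is contracting if there are subsets $X_-,X_+\subseteq X$ with disjoint closures in $X$ and with $\sup_{(a,b)\in X_-\times X_+}(a|b)<\infty$, such that $\gamma(X\setminus X_-)\subseteq X_+$ for every $\gamma\in A$, and $o\notin\overline{X_+}\cup\overline{X_-}$. **Theorem.** Let $\Gamma$ be a sub-semigroup of the isometry group $\mathrm{Isom}(X)$ whose limit set $\Lambda_\Gamma=\partial(\Gamma o)$ contains at least two points. Then there is a non-empty sub-semigroup $\Gamma'$ of $\Gamma$ that is contracting and satisfies $h_{\Gamma'}=h_\Gamma$. -/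

import Mathlib

open Filter Topology Set

/-- The Gromov product `(x | y)` seen from the base point `o`. -/
noncomputable def gromovProduct {X : Type*} [MetricSpace X] (o x y : X) : ℝ :=
  (dist x o + dist y o - dist x y) / 2

/-- Gromov hyperbolicity, expressed with Gromov products seen from `o`. -/
def IsGromovHyperbolic {X : Type*} [MetricSpace X] (o : X) : Prop :=
  ∃ δ : ℝ, 0 ≤ δ ∧ ∀ x y z : X,
    min (gromovProduct o x y) (gromovProduct o y z) - δ ≤ gromovProduct o x z

/-- `(x i | y j)` tends to infinity as `i` and `j` do. -/
def GromovAsymptotic {X : Type*} [MetricSpace X] (o : X) (x y : ℕ → X) : Prop :=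
  Tendsto (fun p : ℕ × ℕ => gromovProduct o (x p.1) (y p.2)) atTop atTop

/-- Sequences of `X` that converge to infinity in the sense of Gromov. -/
def GromovSequence {X : Type*} [MetricSpace X] (o : X) : Type _ :=
  {x : ℕ → X // GromovAsymptotic o x x}

theorem gromovProduct_comm {X : Type*} [MetricSpace X] (o x y : X) :
    gromovProduct o x y = gromovProduct o y x := by
  unfold gromovProduct
  rw [dist_comm x y]
  ring

theorem GromovAsymptotic.symm {X : Type*} [MetricSpace X] {o : X} {x y : ℕ → X}
    (h : GromovAsymptotic o x y) : GromovAsymptotic o y x := by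
  unfold GromovAsymptotic at h ⊢
  rw [tendsto_atTop_atTop] at h ⊢
  intro b
  obtain ⟨⟨i, j⟩, hij⟩ := h b
  refine ⟨(j, i), ?_⟩
  rintro ⟨m, n⟩ ⟨hm, hn⟩
  have h1 := hij (n, m) ⟨hn, hm⟩
  rwa [gromovProduct_comm] at h1

theorem GromovAsymptotic.trans {X : Type*} [MetricSpace X] {o : X} (hX : IsGromovHyperbolic o)
    {x y z : ℕ → X} (h : GromovAsymptotic o x y) (h' : GromovAsymptotic o y z) :
    GromovAsymptotic o x z := by
  obtain ⟨δ, -, hδ⟩ := hX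
  unfold GromovAsymptotic at h h' ⊢
  rw [tendsto_atTop_atTop] at h h' ⊢
  intro b
  obtain ⟨⟨i, j⟩, hij⟩ := h (b + δ)
  obtain ⟨⟨k, l⟩, hkl⟩ := h' (b + δ)
  refine ⟨(i, l), ?_⟩
  rintro ⟨m, n⟩ ⟨hm, hn⟩
  have h1 := hij (m, max j k) ⟨hm, le_max_left j k⟩
  have h2 := hkl (max j k, n) ⟨le_max_right j k, hn⟩
  have h3 := hδ (x m) (y (max j k)) (z n)
  have h4 := le_min h1 h2
  simp only at h4 ⊢
  linarith

/-- Two sequences converging to infinity are equivalent if `(x i | y j) → ∞`. -/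
def gromovSetoid {X : Type*} [MetricSpace X] (o : X) (hX : IsGromovHyperbolic o) :
    Setoid (GromovSequence o) where
  r x y := GromovAsymptotic o x.1 y.1
  iseqv := ⟨fun x => x.2, fun h => h.symm, fun h h' => h.trans hX h'⟩

/-- The Gromov boundary `∂X`. -/
def GromovBoundary {X : Type*} [MetricSpace X] (o : X) (hX : IsGromovHyperbolic o) : Type _ :=
  Quotient (gromovSetoid o hX)

/-- The boundary point represented by a sequence converging to infinity. -/
def GromovBoundary.mk {X : Type*} [MetricSpace X] (o : X) (hX : IsGromovHyperbolic o)
    (x : GromovSequence o) : GromovBoundary o hX :=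
  Quotient.mk (gromovSetoid o hX) x

/-- The Gromov product extended to the boundary: the supremum of `liminf (x i | y j)` over all
sequences `x` and `y` that represent `ξ` and `η`. -/
noncomputable def boundaryProduct {X : Type*} [MetricSpace X] (o : X) (hX : IsGromovHyperbolic o)
    (ξ η : GromovBoundary o hX) : EReal :=
  ⨆ (x : GromovSequence o) (y : GromovSequence o)
    (_ : GromovBoundary.mk o hX x = ξ) (_ : GromovBoundary.mk o hX y = η),
    liminf (fun p : ℕ × ℕ => ((gromovProduct o (x.1 p.1) (y.1 p.2) : ℝ) : EReal)) atTop

/-- The ball `β(ξ, r)`, restricted to the boundary. -/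
def boundaryBall {X : Type*} [MetricSpace X] (o : X) (hX : IsGromovHyperbolic o)
    (ξ : GromovBoundary o hX) (r : ℝ) : Set (GromovBoundary o hX) :=
  {η | ((-Real.log r : ℝ) : EReal) < boundaryProduct o hX η ξ}

/-- The topology of the boundary, in which the balls `β(ξ, r)`, `r > 0`, are the basic
neighbourhoods of `ξ`. -/
instance gromovBoundaryTopology {X : Type*} [MetricSpace X] (o : X)
    (hX : IsGromovHyperbolic o) : TopologicalSpace (GromovBoundary o hX) where
  IsOpen U := ∀ ξ ∈ U, ∃ r : ℝ, 0 < r ∧ boundaryBall o hX ξ r ⊆ U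
  isOpen_univ := fun _ _ => ⟨1, one_pos, subset_univ _⟩
  isOpen_inter := by
    rintro U V hU hV ξ ⟨hξU, hξV⟩
    obtain ⟨r, hr, hrU⟩ := hU ξ hξU
    obtain ⟨s, hs, hsV⟩ := hV ξ hξV
    have key : ∀ t : ℝ, min r s ≤ t → boundaryBall o hX ξ (min r s) ⊆ boundaryBall o hX ξ t := by
      intro t ht η hη
      have hη' : ((-Real.log (min r s) : ℝ) : EReal) < boundaryProduct o hX η ξ := hη
      have hle : ((-Real.log t : ℝ) : EReal) ≤ ((-Real.log (min r s) : ℝ) : EReal) :=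
        EReal.coe_le_coe_iff.2 (neg_le_neg (Real.log_le_log (lt_min hr hs) ht))
      exact lt_of_le_of_lt hle hη'
    exact ⟨min r s, lt_min hr hs, subset_inter ((key r (min_le_left _ _)).trans hrU)
      ((key s (min_le_right _ _)).trans hsV)⟩
  isOpen_sUnion := by
    rintro S hS ξ ⟨U, hU, hξ⟩
    obtain ⟨r, hr, hrU⟩ := hS U hU ξ hξ
    exact ⟨r, hr, hrU.trans (subset_sUnion_of_mem hU)⟩

/-- The boundary `∂A ⊆ ∂X` of a part `A` of `X`. -/
def boundaryOf {X : Type*} [MetricSpace X] (o : X) (hX : IsGromovHyperbolic o) (A : Set X) :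
    Set (GromovBoundary o hX) :=
  {ξ | ∃ x : GromovSequence o, (∀ i, x.1 i ∈ A) ∧ GromovBoundary.mk o hX x = ξ}

/-- The orbit `A o` of the base point under a set `A` of isometries. -/
def isomOrbit {X : Type*} [MetricSpace X] (o : X) (A : Set (X ≃ᵢ X)) : Set X :=
  (fun γ : X ≃ᵢ X => γ o) '' A

/-- The limit set of a set of isometries. -/
def limitSet {X : Type*} [MetricSpace X] (o : X) (hX : IsGromovHyperbolic o)
    (A : Set (X ≃ᵢ X)) : Set (GromovBoundary o hX) :=
  boundaryOf o hX (isomOrbit o A)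

/-- The critical exponent `limsup (1/n) log #(B(o, n) ∩ P)` of a part `P` of `X`, with
`log 0 = -∞` and `log ∞ = ∞`. -/
noncomputable def criticalExponent {X : Type*} [MetricSpace X] (o : X) (P : Set X) : EReal :=
  limsup (fun n : ℕ =>
    ENNReal.log (((Metric.ball o (n : ℝ) ∩ P).encard : ℕ∞) : ENNReal) / ((n : ℝ) : EReal)) atTop

/-- A part of `X` is separated if it is `ε`-separated for some `ε > 0`. -/
def IsSeparatedPart {X : Type*} [MetricSpace X] (S : Set X) : Prop :=
  ∃ ε : ℝ, 0 < ε ∧ ∀ x ∈ S, ∀ y ∈ S, x ≠ y → ε < dist x y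

open Classical in
/-- The entropy of a part `P` of `X`, with the convention that it is `0` for `P = ∅`. -/
noncomputable def partEntropy {X : Type*} [MetricSpace X] (o : X) (P : Set X) : EReal :=
  if P = ∅ then 0
  else ⨆ (S : Set X) (_ : IsSeparatedPart S), criticalExponent o (P ∩ S)

/-- The entropy of a set of isometries is the entropy of its orbit. -/
noncomputable def isomEntropy {X : Type*} [MetricSpace X] (o : X) (A : Set (X ≃ᵢ X)) : EReal :=
  partEntropy o (isomOrbit o A)

/-- `A` and `B` have disjoint closures in `X`, and `sup (a | b) < C`. -/
def CDisjoint {X : Type*} [MetricSpace X] (o : X) (C : ℝ) (A B : Set X) : Prop :=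
  Disjoint (closure A) (closure B) ∧
    (⨆ (a ∈ A) (b ∈ B), ((gromovProduct o a b : ℝ) : EReal)) < (C : EReal)

/-- Gromov-disjoint parts of `X`. -/
def GromovDisjoint {X : Type*} [MetricSpace X] (o : X) (A B : Set X) : Prop :=
  ∃ C : ℝ, 0 < C ∧ CDisjoint o C A B

/-- A set `A` of isometries is contracting if there are Gromov-disjoint `Xm` (for `X₋`) and `Xp`
(for `X₊`) with `A (X \ X₋) ⊆ X₊` and with `o` outside their closures. -/
def IsContracting {X : Type*} [MetricSpace X] (o : X) (A : Set (X ≃ᵢ X)) : Prop :=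
  ∃ Xm Xp : Set X, GromovDisjoint o Xm Xp ∧
    (∀ γ ∈ A, ∀ x : X, x ∉ Xm → γ x ∈ Xp) ∧
    o ∉ closure Xp ∪ closure Xm

/-! Write |γ| for d(γo, o). By (γy|γo) = |γ| - (γ⁻¹o|y), an isometry sends every point that is not
in the direction of γ⁻¹o far into the direction of γo. Hence, for v long with vo and v⁻¹o in
different directions, vhv is contracting as soon as h does not carry the direction of vo to that of
v⁻¹o.

Two limit points give long p, q in Γ with different directions. Every γ⁻¹o avoids one of them, so
the orbit is a union of two parts, one of which has the full entropy (`partEntropy_union_le`); say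
the part that avoids p. `exists_hyperbolic` gives u in Γ whose direction avoids p⁻¹o, and v is a
high power of u. For γ in that part let h = u^k γ p, where k is the moment at which left
multiplication by u stops shortening. If h is long, its directions suit v
(`gromovProduct_le_of_long`); if h is short, it may need one correction w, the same for all h
(`gromovProduct_le_of_short`). So vhv or vwhv lies in a fixed contracting sub-semigroup Γ'.

The new orbit point is at bounded distance from the image of γo under vu^k or vwu^k. The exponent k
takes linearly many values, so on separated sets the passage from Γ to Γ' is linear-to-one, which
exponential growth does not see (`isomEntropy_le_of_labels`). -/

open Filter Topology Set

/-! ### Gromov products and isometries -/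

section Geometry

variable {X : Type*} [MetricSpace X] {o : X}

theorem gromovProduct_self (o x : X) : gromovProduct o x x = dist x o := by
  simp [gromovProduct]

theorem gromovProduct_le_dist_right (o x y : X) : gromovProduct o x y ≤ dist y o := by
  unfold gromovProduct
  linarith [dist_triangle x y o]

theorem gromovProduct_base_left (o y : X) : gromovProduct o o y = 0 := by
  simp [gromovProduct, dist_comm]

theorem continuous_gromovProduct_left (o y : X) : Continuous fun x => gromovProduct o x y := by
  unfold gromovProduct
  fun_prop

theorem dist_inv_apply (γ : X ≃ᵢ X) (x y : X) : dist (γ⁻¹ x) y = dist x (γ y) := by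
  rw [← γ.dist_eq (γ⁻¹ x) y, IsometryEquiv.apply_inv_self]

theorem dist_inv_base (γ : X ≃ᵢ X) (o : X) : dist (γ⁻¹ o) o = dist (γ o) o := by
  rw [dist_inv_apply, dist_comm]

/-- The source of all the dynamics: the further y is from the direction of γ⁻¹o, the deeper γy lies
in that of γo. -/
theorem gromovProduct_apply_base (γ : X ≃ᵢ X) (o y : X) :
    gromovProduct o (γ y) (γ o) = dist (γ o) o - gromovProduct o (γ⁻¹ o) y := by
  unfold gromovProduct
  rw [dist_inv_base, dist_inv_apply, γ.dist_eq, dist_comm o (γ y)]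
  ring

theorem gromovProduct_inv_apply_base (γ : X ≃ᵢ X) (o y : X) :
    gromovProduct o (γ⁻¹ y) (γ⁻¹ o) = dist (γ o) o - gromovProduct o (γ o) y := by
  rw [gromovProduct_apply_base, inv_inv, dist_inv_base]

theorem dist_mul_apply_base (a b : X ≃ᵢ X) (o : X) :
    dist ((a * b) o) o = dist (a o) o + dist (b o) o - 2 * gromovProduct o (a⁻¹ o) (b o) := by
  unfold gromovProduct
  rw [dist_inv_base, dist_inv_apply, IsometryEquiv.mul_apply, dist_comm o]
  ring

theorem dist_mul_apply_base_le (a b : X ≃ᵢ X) (o : X) :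
    dist ((a * b) o) o ≤ dist (a o) o + dist (b o) o := by
  have h := dist_triangle ((a * b) o) (a o) o
  rw [IsometryEquiv.mul_apply, a.dist_eq] at h
  rw [IsometryEquiv.mul_apply]
  linarith

theorem le_gromovProduct_apply (h : X ≃ᵢ X) (o x y : X) :
    gromovProduct o x y - dist (h o) o ≤ gromovProduct o (h x) (h y) := by
  unfold gromovProduct
  have h1 := dist_triangle (h x) o (h o)
  have h2 := dist_triangle (h y) o (h o)
  rw [h.dist_eq, dist_comm o (h o)] at h1 h2
  rw [h.dist_eq]
  linarith

theorem gromovProduct_apply_le (h : X ≃ᵢ X) (o x y : X) :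
    gromovProduct o (h x) (h y) ≤ gromovProduct o x y + dist (h o) o := by
  unfold gromovProduct
  have h1 := dist_triangle (h x) (h o) o
  have h2 := dist_triangle (h y) (h o) o
  rw [h.dist_eq] at h1 h2
  rw [h.dist_eq]
  linarith

variable {δ : ℝ}

/-- If `x` is close to `y` and far from `z`, then `y` is far from `z`. -/
theorem gromovProduct_le_of_lt
    (hδ : ∀ x y z : X, min (gromovProduct o x y) (gromovProduct o y z) - δ ≤ gromovProduct o x z)
    {x y z : X} {c : ℝ} (hxz : gromovProduct o x z ≤ c) (hxy : c + δ < gromovProduct o x y) :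
    gromovProduct o y z ≤ c + δ := by
  have h := hδ x y z
  by_contra! hc
  have := lt_min hxy hc
  linarith

/-! ### Powers of a hyperbolic isometry -/

/-- Powers of a hyperbolic isometry stay in its attracting direction. -/
theorem gromovProduct_pow_le
    (hδ : ∀ x y z : X, min (gromovProduct o x y) (gromovProduct o y z) - δ ≤ gromovProduct o x z)
    {u : X ≃ᵢ X} {T : ℝ} (hδ0 : 0 ≤ δ) (hu : gromovProduct o (u o) (u⁻¹ o) ≤ T)
    (hT : 2 * T + 2 * δ < dist (u o) o) (m : ℕ) :
    gromovProduct o (u⁻¹ o) ((u ^ (m + 1)) o) ≤ T + δ := by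
  induction m with
  | zero =>
    rw [gromovProduct_comm]
    simp only [zero_add, pow_one]
    linarith
  | succ m ih =>
    have h1 : gromovProduct o ((u ^ (m + 2)) o) (u o) =
        dist (u o) o - gromovProduct o (u⁻¹ o) ((u ^ (m + 1)) o) := by
      rw [← gromovProduct_apply_base, ← IsometryEquiv.mul_apply, ← pow_succ']
    rw [gromovProduct_comm]
    -- Each power is compared with `u o` and not with the preceding power, so the errors do not add
    -- up.
    refine gromovProduct_le_of_lt hδ hu ?_
    rw [gromovProduct_comm, h1]
    linarith

theorem le_gromovProduct_pow
    (hδ : ∀ x y z : X, min (gromovProduct o x y) (gromovProduct o y z) - δ ≤ gromovProduct o x z)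
    {u : X ≃ᵢ X} {T : ℝ} (hδ0 : 0 ≤ δ) (hu : gromovProduct o (u o) (u⁻¹ o) ≤ T)
    (hT : 2 * T + 2 * δ < dist (u o) o) (m : ℕ) :
    dist (u o) o - (T + δ) ≤ gromovProduct o (u o) ((u ^ (m + 2)) o) := by
  rw [gromovProduct_comm, pow_succ', IsometryEquiv.mul_apply, gromovProduct_apply_base]
  linarith [gromovProduct_pow_le hδ hδ0 hu hT m]

theorem le_dist_pow
    (hδ : ∀ x y z : X, min (gromovProduct o x y) (gromovProduct o y z) - δ ≤ gromovProduct o x z)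
    {u : X ≃ᵢ X} {T : ℝ} (hδ0 : 0 ≤ δ) (hu : gromovProduct o (u o) (u⁻¹ o) ≤ T)
    (hT : 2 * T + 2 * δ + 1 ≤ dist (u o) o) (m : ℕ) :
    (m : ℝ) ≤ dist ((u ^ (m + 1)) o) o - dist (u o) o := by
  induction m with
  | zero => simp
  | succ m ih =>
    rw [pow_succ', dist_mul_apply_base]
    have := gromovProduct_pow_le hδ hδ0 hu (by linarith) m
    push_cast
    linarith

/-- A long hyperbolic isometry has arbitrarily long powers with the same directions. -/
theorem exists_pow_long
    (hδ : ∀ x y z : X, min (gromovProduct o x y) (gromovProduct o y z) - δ ≤ gromovProduct o x z)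
    {u : X ≃ᵢ X} {T : ℝ} (hδ0 : 0 ≤ δ) (hu : gromovProduct o (u o) (u⁻¹ o) ≤ T)
    (hT : 2 * T + 4 * δ + 1 ≤ dist (u o) o) (M : ℝ) :
    ∃ m : ℕ, M ≤ dist ((u ^ (m + 2)) o) o ∧
      dist (u o) o - (T + δ) ≤ gromovProduct o (u o) ((u ^ (m + 2)) o) ∧
      dist (u o) o - (T + δ) ≤ gromovProduct o (u⁻¹ o) ((u ^ (m + 2))⁻¹ o) ∧
      gromovProduct o ((u ^ (m + 2)) o) ((u ^ (m + 2))⁻¹ o) ≤ T + 2 * δ := by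
  obtain ⟨m, hm⟩ := exists_nat_ge M
  have hu' : gromovProduct o (u⁻¹ o) (u⁻¹⁻¹ o) ≤ T := by
    rwa [inv_inv, gromovProduct_comm]
  have h1 := le_gromovProduct_pow hδ hδ0 hu (by linarith) m
  have h2 := le_gromovProduct_pow hδ hδ0 hu' (by rw [dist_inv_base]; linarith) m
  have h3 := le_dist_pow hδ hδ0 hu (by linarith) (m + 1)
  rw [dist_inv_base, inv_pow] at h2
  refine ⟨m, ?_, h1, h2, ?_⟩
  · push_cast at h3
    linarith [dist_nonneg (x := u o) (y := o)]
  · have h4 := gromovProduct_pow_le hδ hδ0 hu (by linarith) (m + 1)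
    rw [gromovProduct_comm]
    have := gromovProduct_le_of_lt hδ (z := (u ^ (m + 2)) o) h4 (y := (u ^ (m + 2))⁻¹ o)
      (by linarith)
    linarith

/-! ### Length reduction and the choice of a hyperbolic element -/

/-- Left multiplication by powers of `u` until the length stops decreasing. -/
theorem exists_reduced_pow_mul
    (hδ : ∀ x y z : X, min (gromovProduct o x y) (gromovProduct o y z) - δ ≤ gromovProduct o x z)
    (hδ0 : 0 ≤ δ) (u γ : X ≃ᵢ X) :
    ∃ k : ℕ, (k : ℝ) ≤ dist (γ o) o ∧ dist ((u ^ k * γ) o) o ≤ dist (γ o) o ∧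
      dist ((u ^ k * γ) o) o - dist (u o) o ≤ gromovProduct o (γ⁻¹ o) ((u ^ k * γ)⁻¹ o) ∧
      2 * gromovProduct o (u⁻¹ o) ((u ^ k * γ) o) ≤ dist (u o) o + δ + 1 := by
  by_contra! hc
  -- While the last inequality fails, each step shortens by more than δ + 1: the 1 bounds the number
  -- of steps, and the δ pays for the hyperbolic inequality that keeps the inverse in the direction
  -- of `γ⁻¹ o`.
  have key : ∀ k : ℕ, (k : ℝ) ≤ dist (γ o) o - dist ((u ^ k * γ) o) o ∧
      dist ((u ^ k * γ) o) o - dist (u o) o ≤ gromovProduct o (γ⁻¹ o) ((u ^ k * γ)⁻¹ o) := by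
    intro k
    induction k with
    | zero => simp [gromovProduct_self, dist_inv_base]
    | succ k ih =>
      obtain ⟨h1, h2⟩ := ih
      have hk0 : (0 : ℝ) ≤ k := k.cast_nonneg
      have h3 := hc k (by linarith [dist_nonneg (x := (u ^ k * γ) o) (y := o)]) (by linarith) h2
      set w := u ^ k * γ with hw
      have e : u ^ (k + 1) * γ = u * w := by rw [hw, pow_succ', mul_assoc]
      have h4 := dist_mul_apply_base u w o
      have h5 := gromovProduct_inv_apply_base w o (u⁻¹ o)
      have h6 := gromovProduct_le_dist_right o (w o) (u⁻¹ o)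
      rw [dist_inv_base] at h6
      have h7 := hδ (γ⁻¹ o) (w⁻¹ o) ((u * w)⁻¹ o)
      have e' : (u * w)⁻¹ o = w⁻¹ (u⁻¹ o) := by rw [mul_inv_rev, IsometryEquiv.mul_apply]
      rw [e'] at h7
      rw [e, e']
      rw [gromovProduct_comm] at h5
      have h8 := le_min h2 (by linarith : dist (w o) o - dist (u o) o ≤
        gromovProduct o (w⁻¹ o) (w⁻¹ (u⁻¹ o)))
      push_cast
      constructor <;> linarith
  obtain ⟨n, hn⟩ := exists_nat_gt (dist (γ o) o)
  have := (key n).1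
  linarith [dist_nonneg (x := (u ^ n * γ) o) (y := o)]

/-- From two long elements in different directions, one gets a hyperbolic element whose attracting
direction avoids the repelling direction of the first one. -/
theorem exists_hyperbolic
    (hδ : ∀ x y z : X, min (gromovProduct o x y) (gromovProduct o y z) - δ ≤ gromovProduct o x z)
    (hδ0 : 0 ≤ δ) {Γ : Subsemigroup (X ≃ᵢ X)} {p q : X ≃ᵢ X} (hp : p ∈ Γ) (hq : q ∈ Γ) {C L : ℝ}
    (hC : 0 ≤ C) (hpq : gromovProduct o (p o) (q o) ≤ C) (hL : 2 * C + 4 * δ < L)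
    (hpL : L ≤ dist (p o) o) (hqL : L ≤ dist (q o) o) :
    ∃ u ∈ Γ, gromovProduct o (u o) (u⁻¹ o) ≤ C + 3 * δ ∧
      gromovProduct o (u o) (p⁻¹ o) ≤ C + 3 * δ ∧ L - (C + δ) ≤ dist (u o) o := by
  by_cases h1 : gromovProduct o (p o) (p⁻¹ o) ≤ C + 3 * δ
  · exact ⟨p, hp, h1, h1, by linarith⟩
  push Not at h1
  have hpi : gromovProduct o (p⁻¹ o) (q o) ≤ C + δ :=
    gromovProduct_le_of_lt hδ hpq (by linarith)
  by_cases h2 : gromovProduct o (q o) (q⁻¹ o) ≤ C + 3 * δ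
  · refine ⟨q, hq, h2, ?_, by linarith⟩
    rw [gromovProduct_comm]
    linarith
  push Not at h2
  have hqi : gromovProduct o (q⁻¹ o) (p o) ≤ C + δ :=
    gromovProduct_le_of_lt hδ (by rwa [gromovProduct_comm]) (by linarith)
  -- Now neither p nor q is hyperbolic: each shares its direction with its inverse. So `q * p` has
  -- little cancellation; it points along q, and its inverse along `p⁻¹ o`.
  have e1 := gromovProduct_apply_base q o (p o)
  have e2 := gromovProduct_inv_apply_base p o (q⁻¹ o)
  rw [gromovProduct_comm o (p o)] at e2
  rw [← IsometryEquiv.mul_apply] at e1 e2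
  rw [← mul_inv_rev] at e2
  have h3 : gromovProduct o ((q * p) o) (p⁻¹ o) ≤ C + δ + δ := by
    refine gromovProduct_le_of_lt hδ (x := q o) ?_ ?_
    · rwa [gromovProduct_comm]
    · rw [gromovProduct_comm]
      linarith
  have h4 : gromovProduct o ((q * p)⁻¹ o) ((q * p) o) ≤ C + δ + δ + δ := by
    refine gromovProduct_le_of_lt hδ (x := p⁻¹ o) ?_ ?_
    · rwa [gromovProduct_comm]
    · rw [gromovProduct_comm]
      linarith
  refine ⟨q * p, Γ.mul_mem hq hp, ?_, by linarith, ?_⟩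
  · rw [gromovProduct_comm]
    linarith
  · have := gromovProduct_le_dist_right o (q o) ((q * p) o)
    rw [gromovProduct_comm] at this
    linarith

/-! ### Shadows and isometries that contract between them -/

/-- The points of `X` in the direction of `a`, up to depth `R`. -/
def gromovShadow (o a : X) (R : ℝ) : Set X := {x | R ≤ gromovProduct o x a}

theorem isClosed_gromovShadow (o a : X) (R : ℝ) : IsClosed (gromovShadow o a R) :=
  isClosed_le continuous_const (continuous_gromovProduct_left o a)

/-- Replacing a and b by points of their shadows costs δ each, hence the condition on `R`. The base
point has product 0 with every point, so it is in no shadow of positive depth. -/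
theorem isContracting_of_gromovShadow
    (hδ : ∀ x y z : X, min (gromovProduct o x y) (gromovProduct o y z) - δ ≤ gromovProduct o x z)
    (hδ0 : 0 ≤ δ) {a b : X} {T R : ℝ} (hT : 0 ≤ T) (hab : gromovProduct o a b ≤ T)
    (hR : T + 2 * δ < R) {A : Set (X ≃ᵢ X)}
    (hA : ∀ γ ∈ A, ∀ x ∉ gromovShadow o b R, γ x ∈ gromovShadow o a R) : IsContracting o A := by
  have key : ∀ x ∈ gromovShadow o a R, gromovProduct o x b ≤ T + δ := by
    intro x hx
    have hx' : R ≤ gromovProduct o x a := hx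
    exact gromovProduct_le_of_lt hδ hab (by rw [gromovProduct_comm]; linarith)
  refine ⟨gromovShadow o b R, gromovShadow o a R, ⟨T + 2 * δ + 1, by positivity, ?_, ?_⟩, hA, ?_⟩
  · rw [(isClosed_gromovShadow _ _ _).closure_eq, (isClosed_gromovShadow _ _ _).closure_eq,
      Set.disjoint_left]
    intro x hxb hxa
    have h1 := key x hxa
    have h2 : R ≤ gromovProduct o x b := hxb
    linarith
  · refine lt_of_le_of_lt (b := ((T + 2 * δ : ℝ) : EReal)) ?_ (EReal.coe_lt_coe_iff.2 (by linarith))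
    refine iSup₂_le fun y hy => iSup₂_le fun x hx => EReal.coe_le_coe_iff.2 ?_
    have h1 := key x hx
    have h2 : R ≤ gromovProduct o y b := hy
    rw [gromovProduct_comm] at h1 h2
    have := gromovProduct_le_of_lt hδ h1 (y := y) (by linarith)
    linarith
  · rw [(isClosed_gromovShadow _ _ _).closure_eq, (isClosed_gromovShadow _ _ _).closure_eq]
    rintro (h | h)
    all_goals
      have h' : R ≤ gromovProduct o o _ := h
      rw [gromovProduct_base_left] at h'
      linarith

/-- The right factor v pushes the complement of the repelling shadow deep towards `v o`; if h then
avoids the depths of `v⁻¹ o`, the left factor v lands in the attracting shadow. -/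
theorem conj_maps_gromovShadow {v h : X ≃ᵢ X} {R : ℝ}
    (hh : ∀ y, dist (v o) o - R < gromovProduct o y (v o) →
      gromovProduct o (h y) (v⁻¹ o) ≤ dist (v o) o - R) :
    ∀ x ∉ gromovShadow o (v⁻¹ o) R, (v * (h * v)) x ∈ gromovShadow o (v o) R := by
  intro x hx
  have hx' : gromovProduct o x (v⁻¹ o) < R := not_le.1 hx
  change R ≤ gromovProduct o (v (h (v x))) (v o)
  rw [gromovProduct_apply_base, gromovProduct_comm]
  have := hh (v x) (by rw [gromovProduct_apply_base, gromovProduct_comm]; linarith)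
  linarith

/-- Isometries moving `o` far, with directions away from those of `v`, do not create
cancellation. -/
theorem gromovProduct_le_of_long
    (hδ : ∀ x y z : X, min (gromovProduct o x y) (gromovProduct o y z) - δ ≤ gromovProduct o x z)
    {v h : X ≃ᵢ X} {c R : ℝ} (hδ0 : 0 ≤ δ)
    (hh : 2 * c + 3 * δ < dist (h o) o) (h1 : gromovProduct o (h⁻¹ o) (v o) ≤ c)
    (h2 : gromovProduct o (h o) (v⁻¹ o) ≤ c) (hR : R + c + δ ≤ dist (v o) o) (y : X)
    (hy : dist (v o) o - R < gromovProduct o y (v o)) :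
    gromovProduct o (h y) (v⁻¹ o) ≤ dist (v o) o - R := by
  -- y follows `v o`, hence misses `h⁻¹ o`, so h throws it along `h o`, away from `v⁻¹ o`.
  have h3 : gromovProduct o y (h⁻¹ o) ≤ c + δ := by
    rw [gromovProduct_comm] at h1 hy
    exact gromovProduct_le_of_lt hδ h1 (by linarith)
  have h4 := gromovProduct_apply_base h o y
  rw [gromovProduct_comm] at h3 h4
  have := gromovProduct_le_of_lt hδ h2 (y := h y) (by linarith)
  linarith

/-- One isometry corrects all the isometries of bounded displacement that send the attracting
direction of `v` to its repelling direction. -/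
theorem gromovProduct_le_of_short
    (hδ : ∀ x y z : X, min (gromovProduct o x y) (gromovProduct o y z) - δ ≤ gromovProduct o x z)
    {v h w : X ≃ᵢ X} {c T R : ℝ} (hδ0 : 0 ≤ δ) (hR0 : 0 < R) (hv : gromovProduct o (v o) (v⁻¹ o) ≤ T)
    (hc : 0 ≤ c) (hR : R + T + 4 * c + 6 * δ < dist (v o) o)
    (hw : dist (w o) o ≤ c) (hh : dist (h o) o ≤ c) {y₀ y₁ : X}
    (hw₀ : dist (v o) o - R < gromovProduct o y₀ (v o))
    (hw₁ : dist (v o) o - R < gromovProduct o (w y₀) (v⁻¹ o))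
    (hh₀ : dist (v o) o - R < gromovProduct o y₁ (v o))
    (hh₁ : dist (v o) o - R < gromovProduct o (h y₁) (v⁻¹ o)) (y : X)
    (hy : dist (v o) o - R < gromovProduct o y (v o)) :
    gromovProduct o ((w * h) y) (v⁻¹ o) ≤ dist (v o) o - R := by
  set M := dist (v o) o with hM
  -- A bounded displacement keeps deep points of one direction together: if one of them is sent
  -- towards `v⁻¹ o`, all are.
  have key : ∀ g : X ≃ᵢ X, dist (g o) o ≤ c → ∀ z, M - R < gromovProduct o z (v o) →
      M - R < gromovProduct o (g z) (v⁻¹ o) → ∀ x, M - R < gromovProduct o x (v o) →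
      M - R - 2 * δ - c ≤ gromovProduct o (g x) (v⁻¹ o) := by
    intro g hg z hz hgz x hx
    have h1 := hδ x (v o) z
    rw [gromovProduct_comm o (v o) z] at h1
    have h2 := lt_min hx hz
    have h3 := le_gromovProduct_apply g o x z
    have h4 := hδ (g x) (g z) (v⁻¹ o)
    have h5 := le_min (by linarith : M - R - δ - c ≤ gromovProduct o (g x) (g z))
      (by linarith : M - R - δ - c ≤ gromovProduct o (g z) (v⁻¹ o))
    linarith
  have h1 := key h hh y₁ hh₀ hh₁ y hy
  have h2 := key w hw y₀ hw₀ hw₁ (v o) (by rw [gromovProduct_self]; linarith)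
  have h3 := le_gromovProduct_apply w o (h y) (v⁻¹ o)
  have h4 := gromovProduct_apply_le w o (v o) (v⁻¹ o)
  -- As w brings `v o` to the direction of `v⁻¹ o`, it takes `v⁻¹ o`, and with it `h y`, away from
  -- there.
  have h5 : gromovProduct o (v⁻¹ o) (w (v⁻¹ o)) ≤ T + c + δ :=
    gromovProduct_le_of_lt hδ (x := w (v o)) (by linarith) (by linarith)
  rw [gromovProduct_comm] at h5
  rw [gromovProduct_comm o (w (h y))] at h3
  have h6 := gromovProduct_le_of_lt hδ h5 (y := w (h y)) (by linarith)
  rw [IsometryEquiv.mul_apply]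
  linarith

/-! ### The contracting sub-semigroup -/

theorem pow_mul_mem {Γ : Subsemigroup (X ≃ᵢ X)} {u γ : X ≃ᵢ X} (hu : u ∈ Γ) (hγ : γ ∈ Γ) (k : ℕ) :
    u ^ k * γ ∈ Γ := by
  induction k with
  | zero => simpa
  | succ k ih => rw [pow_succ', mul_assoc]; exact Γ.mul_mem hu ih

/-- The elements of `Γ` that map the complement of `B` into `A`, when `A` and `B` are disjoint. -/
def contractingPart (Γ : Subsemigroup (X ≃ᵢ X)) (A B : Set X) (h : Disjoint A B) :
    Subsemigroup (X ≃ᵢ X) where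
  carrier := {γ | γ ∈ Γ ∧ ∀ x ∉ B, γ x ∈ A}
  mul_mem' := fun ha hb => ⟨Γ.mul_mem ha.1 hb.1,
    fun x hx => ha.2 _ (Set.disjoint_left.1 h (hb.2 x hx))⟩

/-- All the elements `γ` of `Γ` such that `γ⁻¹ o` is not in the direction of `p o` can be brought
into one contracting sub-semigroup, by finitely many isometries and the powers of one isometry. -/
theorem exists_contracting_subsemigroup
    (hδ : ∀ x y z : X, min (gromovProduct o x y) (gromovProduct o y z) - δ ≤ gromovProduct o x z)
    (hδ0 : 0 ≤ δ) {Γ : Subsemigroup (X ≃ᵢ X)} {p q : X ≃ᵢ X} (hp : p ∈ Γ) (hq : q ∈ Γ) {C L : ℝ}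
    (hC : 0 ≤ C) (hpq : gromovProduct o (p o) (q o) ≤ C) (hL : 20 * C + 100 * δ + 20 < L)
    (hpL : L ≤ dist (p o) o) (hqL : L ≤ dist (q o) o) :
    ∃ Γ' : Subsemigroup (X ≃ᵢ X), Γ' ≤ Γ ∧ (Γ' : Set (X ≃ᵢ X)).Nonempty ∧
      IsContracting o (Γ' : Set (X ≃ᵢ X)) ∧
      ∃ (D : ℕ) (u v w : X ≃ᵢ X), ∀ γ ∈ Γ, gromovProduct o (γ⁻¹ o) (p o) ≤ C + δ →
        ∃ γ' ∈ Γ', dist (γ' o) o ≤ dist (γ o) o + D ∧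
          ∃ k : ℕ, (k : ℝ) ≤ dist (γ o) o + D ∧
            (dist (γ' o) ((v * u ^ k) (γ o)) ≤ D ∨ dist (γ' o) ((w * u ^ k) (γ o)) ≤ D) := by
  obtain ⟨u, huΓ, hu1, hu2, hu3⟩ :=
    exists_hyperbolic hδ hδ0 hp hq hC hpq (by linarith) hpL hqL
  set T := C + 3 * δ with hT
  set ℓ := dist (u o) o with hℓ
  set c := ℓ + T + 3 * δ with hc
  -- `c'` separates long h from short ones. `R` exceeds by 2δ the bound T + 2δ on the product of `v
  -- o` and `v⁻¹ o`. The length asked of v below gives 2R ≤ |v|, which makes v itself contracting,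
  -- and suffices for the short case.
  set c' := 2 * c + 3 * δ with hc'
  set R := T + 4 * δ + 1 with hR
  obtain ⟨m, hM, hm1, hm2, hm3⟩ := exists_pow_long hδ hδ0 hu1 (by linarith)
    (2 * R + T + 4 * c' + 8 * δ + 1)
  have hvΓ : u ^ (m + 2) ∈ Γ := by
    rw [pow_succ]
    exact pow_mul_mem huΓ huΓ _
  set v := u ^ (m + 2) with hv
  rw [← hℓ] at hm1 hm2
  have hdisj : Disjoint (gromovShadow o (v o) R) (gromovShadow o (v⁻¹ o) R) := by
    rw [Set.disjoint_left]
    intro x hx1 hx2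
    have h1 : R ≤ gromovProduct o x (v o) := hx1
    have h2 : R ≤ gromovProduct o x (v⁻¹ o) := hx2
    rw [gromovProduct_comm] at h1
    have := hδ (v o) x (v⁻¹ o)
    have := le_min h1 h2
    linarith
  refine ⟨contractingPart Γ _ _ hdisj, fun γ hγ => hγ.1, ⟨v, hvΓ, fun x hx => ?_⟩,
    isContracting_of_gromovShadow hδ hδ0 (by linarith) hm3 (by linarith) fun γ hγ => hγ.2, ?_⟩
  · have hx' : gromovProduct o x (v⁻¹ o) < R := not_le.1 hx
    change R ≤ gromovProduct o (v x) (v o)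
    rw [gromovProduct_apply_base, gromovProduct_comm]
    linarith
  -- Any short element of Γ that exchanges the directions corrects all the others; if there is none,
  -- no correction is needed.
  obtain ⟨w, hw⟩ : ∃ w : X ≃ᵢ X, ∀ h ∈ Γ, dist (h o) o ≤ c' →
      (v * (h * v) ∈ contractingPart Γ _ _ hdisj ∨
        v * ((w * h) * v) ∈ contractingPart Γ _ _ hdisj) := by
    by_cases hbad : ∃ w ∈ Γ, dist (w o) o ≤ c' ∧ ∃ y, dist (v o) o - R < gromovProduct o y (v o) ∧
        dist (v o) o - R < gromovProduct o (w y) (v⁻¹ o)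
    · obtain ⟨w, hwΓ, hwc, y₀, hw₀, hw₁⟩ := hbad
      refine ⟨w, fun h hh hhc => ?_⟩
      by_cases hbad' : ∃ y, dist (v o) o - R < gromovProduct o y (v o) ∧
        dist (v o) o - R < gromovProduct o (h y) (v⁻¹ o)
      · obtain ⟨y₁, hh₀, hh₁⟩ := hbad'
        refine Or.inr ⟨Γ.mul_mem hvΓ (Γ.mul_mem (Γ.mul_mem hwΓ hh) hvΓ),
          conj_maps_gromovShadow fun y hy => ?_⟩
        exact gromovProduct_le_of_short hδ hδ0 (by linarith) hm3 (by linarith) (by linarith)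
          hwc hhc hw₀ hw₁ hh₀ hh₁ y hy
      · push Not at hbad'
        exact Or.inl ⟨Γ.mul_mem hvΓ (Γ.mul_mem hh hvΓ), conj_maps_gromovShadow hbad'⟩
    · push Not at hbad
      exact ⟨1, fun h hh hhc => Or.inl
        ⟨Γ.mul_mem hvΓ (Γ.mul_mem hh hvΓ), conj_maps_gromovShadow (hbad h hh hhc)⟩⟩
  obtain ⟨D, hD⟩ := exists_nat_ge (2 * dist (v o) o + dist (w o) o + dist (p o) o)
  refine ⟨D, u, v, v * w, fun γ hγ hγp => ?_⟩
  have hv0 : 0 ≤ dist (v o) o := dist_nonneg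
  have hw0 : 0 ≤ dist (w o) o := dist_nonneg
  -- This is the use of the right factor p: since `γ⁻¹ o` avoids `p o`, applying `p⁻¹` sends it
  -- towards `p⁻¹ o`, a direction that u avoids.
  have hγ1 : gromovProduct o ((γ * p)⁻¹ o) (u o) ≤ T + δ := by
    have h1 := gromovProduct_inv_apply_base p o (γ⁻¹ o)
    rw [← IsometryEquiv.mul_apply, ← mul_inv_rev, gromovProduct_comm o (p o)] at h1
    rw [gromovProduct_comm] at hu2 h1
    exact gromovProduct_le_of_lt hδ hu2 (by linarith)
  obtain ⟨k, hk1, hk2, hk3, hk4⟩ := exists_reduced_pow_mul hδ hδ0 u (γ * p)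
  have hlen := dist_mul_apply_base_le γ p o
  have hhΓ : u ^ k * (γ * p) ∈ Γ := pow_mul_mem huΓ (Γ.mul_mem hγ hp) k
  set h := u ^ k * (γ * p) with hh
  have hclose : ∀ a b : X ≃ᵢ X, dist ((a * (u ^ k * (γ * p)) * b) o) ((a * u ^ k) (γ o)) ≤
      dist (p o) o + dist (b o) o := by
    intro a b
    have e : (a * (u ^ k * (γ * p)) * b) o = (a * u ^ k) (γ ((p * b) o)) := by
      simp only [IsometryEquiv.mul_apply]
    rw [e, IsometryEquiv.dist_eq, IsometryEquiv.dist_eq]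
    exact dist_mul_apply_base_le p b o
  have hgood : v * (h * v) ∈ contractingPart Γ _ _ hdisj ∨
      v * ((w * h) * v) ∈ contractingPart Γ _ _ hdisj := by
    rcases le_or_gt (dist (h o) o) c' with hs | hs
    · exact hw h hhΓ hs
    refine Or.inl ⟨Γ.mul_mem hvΓ (Γ.mul_mem hhΓ hvΓ), conj_maps_gromovShadow
      (gromovProduct_le_of_long (c := c) hδ hδ0 hs ?_ ?_ (by linarith))⟩
    -- A long h has its inverse still in the direction of `(γ * p)⁻¹ o`, by `hk3`; the other bound
    -- comes from the stopping rule `hk4`.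
    · have h1 : gromovProduct o (h⁻¹ o) (u o) ≤ T + δ + δ :=
        gromovProduct_le_of_lt hδ hγ1 (by linarith)
      rw [gromovProduct_comm] at h1 ⊢
      have := gromovProduct_le_of_lt hδ h1 (y := v o) (by linarith)
      linarith
    · rw [gromovProduct_comm]
      have := gromovProduct_le_of_lt hδ (c := (ℓ + δ + 1) / 2) (x := u⁻¹ o) (y := v⁻¹ o)
        (z := h o) (by linarith) (by linarith)
      linarith
  rcases hgood with hg | hg
  · refine ⟨_, hg, ?_, k, by linarith, Or.inl ?_⟩
    · have h1 := dist_mul_apply_base_le v (h * v) o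
      have h2 := dist_mul_apply_base_le h v o
      linarith
    · have := hclose v v
      rw [← mul_assoc]
      linarith
  · refine ⟨_, hg, ?_, k, by linarith, Or.inr ?_⟩
    · have h1 := dist_mul_apply_base_le v (w * h * v) o
      have h2 := dist_mul_apply_base_le (w * h) v o
      have h3 := dist_mul_apply_base_le w h o
      linarith
    · have := hclose (v * w) v
      rw [show v * (w * h * v) = v * w * h * v by simp only [mul_assoc]]
      linarith

end Geometry

/-! ### Entropy and counting -/

section Entropy

variable {X : Type*} [MetricSpace X] {o : X}

theorem criticalExponent_le_of_eventually {P : Set X} {β : ℝ}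
    (h : ∀ᶠ n : ℕ in atTop, (((Metric.ball o (n : ℝ) ∩ P).encard : ℕ∞) : ENNReal) ≤
      ENNReal.ofReal (Real.exp (β * n))) : criticalExponent o P ≤ β := by
  refine limsup_le_of_le (by isBoundedDefault) ?_
  filter_upwards [h, eventually_gt_atTop 0] with n hn hn0
  have hn0' : (0 : EReal) < ((n : ℝ) : EReal) := by exact_mod_cast hn0
  rw [EReal.div_le_iff_le_mul hn0' (EReal.coe_ne_top _)]
  refine (ENNReal.log_monotone hn).trans_eq ?_
  rw [← EReal.exp_coe, EReal.log_exp, EReal.coe_mul, mul_comm]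

theorem eventually_encard_le_of_criticalExponent_lt {P : Set X} {β : ℝ}
    (h : criticalExponent o P < β) :
    ∀ᶠ n : ℕ in atTop, (((Metric.ball o (n : ℝ) ∩ P).encard : ℕ∞) : ENNReal) ≤
      ENNReal.ofReal (Real.exp (β * n)) := by
  filter_upwards [eventually_lt_of_limsup_lt h, eventually_gt_atTop 0] with n hn hn0
  have hn0' : (0 : EReal) < ((n : ℝ) : EReal) := by exact_mod_cast hn0
  have h1 := (EReal.div_le_iff_le_mul hn0' (EReal.coe_ne_top _)).1 hn.le
  rw [mul_comm, ← EReal.coe_mul] at h1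
  rw [← EReal.exp_coe, ← ENNReal.exp_log (((Metric.ball o (n : ℝ) ∩ P).encard : ℕ∞) : ENNReal)]
  exact EReal.exp_monotone h1

theorem criticalExponent_mono {P Q : Set X} (h : P ⊆ Q) :
    criticalExponent o P ≤ criticalExponent o Q := by
  refine limsup_le_limsup ?_
  filter_upwards with n
  refine EReal.div_le_div_right_of_nonneg (by exact_mod_cast n.cast_nonneg) ?_
  refine ENNReal.log_monotone ?_
  exact_mod_cast encard_le_encard (inter_subset_inter_right _ h)

theorem criticalExponent_inter_le_partEntropy {P S : Set X} (hS : IsSeparatedPart S) :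
    criticalExponent o (P ∩ S) ≤ partEntropy o P := by
  unfold partEntropy
  split_ifs with hP
  · refine criticalExponent_le_of_eventually (β := 0) ?_
    simp [hP]
  · exact le_iSup₂ (f := fun (S : Set X) (_ : IsSeparatedPart S) => criticalExponent o (P ∩ S)) S hS

theorem partEntropy_le {P : Set X} {b : EReal} (hb : 0 ≤ b)
    (h : ∀ S, IsSeparatedPart S → criticalExponent o (P ∩ S) ≤ b) : partEntropy o P ≤ b := by
  unfold partEntropy
  split_ifs with hP
  · exact hb
  · exact iSup₂_le h

theorem partEntropy_nonneg (o : X) (P : Set X) : 0 ≤ partEntropy o P := by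
  rcases P.eq_empty_or_nonempty with rfl | ⟨x, hx⟩
  · simp [partEntropy]
  -- A single point already rules out a negative exponent.
  have hS : IsSeparatedPart ({x} : Set X) := by
    refine ⟨1, one_pos, ?_⟩
    rintro a rfl b rfl hab
    exact absurd rfl hab
  refine le_trans ?_ (criticalExponent_inter_le_partEntropy (o := o) (P := P) hS)
  by_contra! hlt
  obtain ⟨β, hβ, hβ0⟩ := EReal.lt_iff_exists_real_btwn.1 hlt
  have hβ0' : β < 0 := by exact_mod_cast hβ0
  obtain ⟨N, hN⟩ := exists_nat_gt (dist x o)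
  obtain ⟨n, hn, hnN⟩ := ((eventually_encard_le_of_criticalExponent_lt hβ).and
    (eventually_ge_atTop (N + 1))).exists
  have hxn : x ∈ Metric.ball o (n : ℝ) ∩ (P ∩ {x}) := by
    refine ⟨Metric.mem_ball.2 (hN.trans_le ?_), hx, rfl⟩
    exact_mod_cast (Nat.le_succ N).trans hnN
  have h1 : (1 : ℕ∞) ≤ (Metric.ball o (n : ℝ) ∩ (P ∩ {x})).encard :=
    one_le_encard_iff_nonempty.2 ⟨x, hxn⟩
  have h2 : (1 : ENNReal) ≤ ENNReal.ofReal (Real.exp (β * n)) :=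
    le_trans (by exact_mod_cast h1) hn
  rw [ENNReal.one_le_ofReal, Real.one_le_exp_iff] at h2
  have hn0 : (0 : ℝ) < n := by
    exact_mod_cast (Nat.succ_pos N).trans_le hnN
  nlinarith

theorem partEntropy_mono {P Q : Set X} (h : P ⊆ Q) : partEntropy o P ≤ partEntropy o Q :=
  partEntropy_le (partEntropy_nonneg o Q) fun _ hS =>
    (criticalExponent_mono (inter_subset_inter_left _ h)).trans
      (criticalExponent_inter_le_partEntropy hS)

/-- The gap between the exponents absorbs a linear factor and a shift of the radius. -/
theorem eventually_mul_exp_le (K D : ℕ) {β' β : ℝ} (h : β' < β) :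
    ∀ᶠ n : ℕ in atTop, (K : ℝ) * (n + 1) * Real.exp (β' * (n + D : ℕ)) ≤ Real.exp (β * n) := by
  -- The 2 comes from n + 1 ≤ 2n; the 1 keeps `A` positive when `K` is 0.
  set A : ℝ := 2 * K * Real.exp (β' * D) + 1 with hA
  have hA0 : 0 < A := by positivity
  have h1 := (isLittleO_pow_exp_pos_mul_atTop 1 (sub_pos.2 h)).bound (inv_pos.2 hA0)
  filter_upwards [tendsto_natCast_atTop_atTop.eventually h1, eventually_ge_atTop 1] with n hn hn1
  have hn1' : (1 : ℝ) ≤ n := by exact_mod_cast hn1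
  rw [pow_one, Real.norm_of_nonneg (by linarith), Real.norm_of_nonneg (Real.exp_pos _).le,
    inv_mul_eq_div, le_div_iff₀ hA0] at hn
  have e1 : Real.exp (β' * (n + D : ℕ)) = Real.exp (β' * D) * Real.exp (β' * n) := by
    rw [← Real.exp_add]
    push_cast
    ring_nf
  have e2 : Real.exp (β * n) = Real.exp ((β - β') * n) * Real.exp (β' * n) := by
    rw [← Real.exp_add]
    ring_nf
  rw [e1, e2, ← mul_assoc]
  refine mul_le_mul_of_nonneg_right (le_trans ?_ hn) (Real.exp_pos _).le
  have h2 : 0 ≤ (K : ℝ) * Real.exp (β' * D) := by positivity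
  rw [hA]
  nlinarith

theorem partEntropy_union_le (o : X) (P Q : Set X) :
    partEntropy o (P ∪ Q) ≤ max (partEntropy o P) (partEntropy o Q) := by
  refine partEntropy_le (le_max_of_le_left (partEntropy_nonneg o P)) fun S hS => ?_
  by_contra! hlt
  obtain ⟨β, hβ, hβ'⟩ := EReal.lt_iff_exists_real_btwn.1 hlt
  obtain ⟨α, hα, hαβ⟩ := EReal.lt_iff_exists_real_btwn.1 hβ
  refine absurd hβ' (not_lt.2 (criticalExponent_le_of_eventually ?_))
  have hP := eventually_encard_le_of_criticalExponent_lt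
    ((criticalExponent_inter_le_partEntropy hS).trans_lt ((le_max_left _ _).trans_lt hα))
  have hQ := eventually_encard_le_of_criticalExponent_lt
    ((criticalExponent_inter_le_partEntropy hS).trans_lt ((le_max_right _ _).trans_lt hα))
  filter_upwards [hP, hQ, eventually_mul_exp_le 2 0 (EReal.coe_lt_coe_iff.1 hαβ)] with n h1 h2 h3
  have h4 : (((Metric.ball o (n : ℝ) ∩ ((P ∪ Q) ∩ S)).encard : ℕ∞) : ENNReal) ≤
      ((Metric.ball o (n : ℝ) ∩ (P ∩ S)).encard : ℕ∞) +
        ((Metric.ball o (n : ℝ) ∩ (Q ∩ S)).encard : ℕ∞) := by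
    rw [union_inter_distrib_right, inter_union_distrib_left]
    exact_mod_cast encard_union_le _ _
  refine (h4.trans (add_le_add h1 h2)).trans ?_
  rw [← ENNReal.ofReal_add (Real.exp_pos _).le (Real.exp_pos _).le]
  refine ENNReal.ofReal_le_ofReal (le_trans ?_ h3)
  have h5 : (0 : ℝ) ≤ n := n.cast_nonneg
  have h6 := Real.exp_pos (α * n)
  push_cast
  simp only [add_zero]
  nlinarith

theorem exists_maximal_separated (A : Set X) :
    ∃ S : Set X, IsSeparatedPart S ∧ S ⊆ A ∧ ∀ x ∈ A, ∃ s ∈ S, dist x s ≤ 1 := by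
  obtain ⟨S, hS⟩ := zorn_subset {S : Set X | S ⊆ A ∧ S.Pairwise fun x y => 1 < dist x y} (by
    intro c hc hchain
    refine ⟨⋃₀ c, ⟨sUnion_subset fun s hs => (hc hs).1, ?_⟩, fun s hs => subset_sUnion_of_mem hs⟩
    exact (pairwise_sUnion hchain.directedOn).2 fun s hs => (hc hs).2)
  refine ⟨S, ⟨1, one_pos, fun x hx y hy hxy => hS.prop.2 hx hy hxy⟩, hS.prop.1, fun x hx => ?_⟩
  by_contra! hfar
  have hins : insert x S ∈ {S : Set X | S ⊆ A ∧ S.Pairwise fun x y => 1 < dist x y} := by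
    refine ⟨insert_subset hx hS.prop.1, hS.prop.2.insert fun y hy _ => ⟨hfar y hy, ?_⟩⟩
    rw [dist_comm]
    exact hfar y hy
  have hxS : x ∈ S := hS.le_of_ge hins (subset_insert x S) (mem_insert x S)
  have := hfar x hxS
  rw [dist_self] at this
  linarith

theorem exists_card_le_of_separated [ProperSpace X] (o : X) (r : ℝ) {ε : ℝ} (hε : 0 < ε) :
    ∃ K : ℕ, ∀ F : Finset X, (∀ x ∈ F, dist x o ≤ r) →
      (∀ x ∈ F, ∀ y ∈ F, x ≠ y → ε < dist x y) → F.card ≤ K := by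
  obtain ⟨t, -, ht, hcov⟩ := (isCompact_closedBall o r).finite_cover_balls (half_pos hε)
  refine ⟨ht.toFinset.card, fun F hF hsep => ?_⟩
  have h : ∀ x ∈ F, ∃ c ∈ t, dist x c < ε / 2 := by
    intro x hx
    have := hcov (Metric.mem_closedBall.2 (hF x hx))
    simpa using this
  choose! f hf hfd using h
  refine Finset.card_le_card_of_injOn f (fun x hx => by simpa using hf x hx) ?_
  intro x hx y hy hxy
  by_contra hne
  have h1 := hsep x hx y hy hne
  have h2 := dist_triangle_right x y (f x)
  have h3 := hfd x hx
  have h4 := hfd y hy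
  rw [← hxy] at h4
  linarith

theorem finite_ball_inter_of_separated [ProperSpace X] (o : X) (r : ℝ) {S : Set X}
    (hS : IsSeparatedPart S) : (Metric.ball o r ∩ S).Finite := by
  obtain ⟨ε, hε, hsep⟩ := hS
  obtain ⟨K, hK⟩ := exists_card_le_of_separated o r hε
  by_contra hinf
  obtain ⟨F, hF, hcard⟩ := Set.Infinite.exists_subset_card_eq hinf (K + 1)
  have := hK F (fun x hx => (Metric.mem_ball.1 (hF hx).1).le)
    fun x hx y hy => hsep x (hF hx).2 y (hF hy).2
  omega

/-- If each element of `A` can be moved close to the orbit of `B` by an isometry that depends on a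
number of choices which is linear in its length, then the entropy of `A` is at most that of `B`. -/
theorem isomEntropy_le_of_labels [ProperSpace X] {A B : Set (X ≃ᵢ X)} (D : ℕ)
    (φ : Bool → ℕ → X ≃ᵢ X)
    (h : ∀ γ ∈ A, ∃ γ' ∈ B, dist (γ' o) o ≤ dist (γ o) o + D ∧
      ∃ (i : Bool) (k : ℕ), (k : ℝ) ≤ dist (γ o) o + D ∧ dist (γ' o) (φ i k (γ o)) ≤ D) :
    isomEntropy o A ≤ isomEntropy o B := by
  classical
  refine partEntropy_le (partEntropy_nonneg _ _) fun S hS => ?_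
  obtain ⟨T, hT, hTB, hTcov⟩ := exists_maximal_separated (isomOrbit o B)
  by_contra! hlt
  obtain ⟨β, hβ, hβ'⟩ := EReal.lt_iff_exists_real_btwn.1 hlt
  obtain ⟨α, hα, hαβ⟩ := EReal.lt_iff_exists_real_btwn.1 hβ
  refine absurd hβ' (not_lt.2 (criticalExponent_le_of_eventually ?_))
  have hTcount := eventually_encard_le_of_criticalExponent_lt
    ((criticalExponent_inter_le_partEntropy hT).trans_lt hα)
  rw [inter_eq_self_of_subset_right hTB] at hTcount
  obtain ⟨ε, hε, hsep⟩ := id hS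
  obtain ⟨K, hK⟩ := exists_card_le_of_separated o (2 * (D + 1)) hε
  have hlabel : ∀ x ∈ isomOrbit o A, ∃ (γ : X ≃ᵢ X) (i : Bool) (k : ℕ) (t : X), γ o = x ∧ t ∈ T ∧
      dist t o ≤ dist x o + D + 1 ∧ (k : ℝ) ≤ dist x o + D ∧ dist t (φ i k x) ≤ D + 1 := by
    rintro x ⟨γ, hγ, rfl⟩
    obtain ⟨γ', hγ', h1, i, k, hk, h2⟩ := h γ hγ
    obtain ⟨t, ht, hd⟩ := hTcov (γ' o) ⟨γ', hγ', rfl⟩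
    rw [dist_comm] at hd
    have h3 := dist_triangle t (γ' o) o
    have h4 := dist_triangle t (γ' o) (φ i k (γ o))
    exact ⟨γ, i, k, t, rfl, ht, by simp only; linarith, hk, by simp only; linarith⟩
  choose! γ i k t hγ ht hto hk htd using hlabel
  have hbound : ∀ n : ℕ, ((Metric.ball o (n : ℝ) ∩ (isomOrbit o A ∩ S)).encard : ℕ∞) ≤
      ((K * (2 * (n + (D + 2))) : ℕ) : ℕ∞) *
        (Metric.ball o ((n + (D + 2) : ℕ) : ℝ) ∩ T).encard := by
    intro n
    have hfin : (Metric.ball o (n : ℝ) ∩ (isomOrbit o A ∩ S)).Finite :=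
      (finite_ball_inter_of_separated o n hS).subset
        (inter_subset_inter_right _ inter_subset_right)
    have hfinT := finite_ball_inter_of_separated o ((n + (D + 2) : ℕ) : ℝ) hT
    have hcard := Finset.card_le_mul_card_image_of_maps_to (s := hfin.toFinset)
      (t := ((Finset.univ : Finset Bool) ×ˢ Finset.range (n + (D + 2))) ×ˢ hfinT.toFinset)
      (f := fun x => ((i x, k x), t x)) (by
        intro x hx
        obtain ⟨hxn, hxA, -⟩ := hfin.mem_toFinset.1 hx
        rw [Metric.mem_ball] at hxn
        have h1 := hk x hxA
        have h2 := hto x hxA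
        simp only [Finset.mem_product, Finset.mem_univ, true_and, Finset.mem_range,
          Set.Finite.mem_toFinset, mem_inter_iff, Metric.mem_ball]
        refine ⟨?_, ?_, ht x hxA⟩
        · have : (k x : ℝ) < ((n + (D + 2) : ℕ) : ℝ) := by push_cast; linarith
          exact_mod_cast this
        · push_cast; linarith) K (by
        rintro ⟨⟨j, l⟩, s⟩ -
        rcases Finset.eq_empty_or_nonempty
          ({x ∈ hfin.toFinset | ((i x, k x), t x) = ((j, l), s)}) with he | ⟨x₀, hx₀⟩
        · rw [he]; simp
        have hmem : ∀ x ∈ ({x ∈ hfin.toFinset | ((i x, k x), t x) = ((j, l), s)} : Finset X),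
            x ∈ isomOrbit o A ∧ x ∈ S ∧ dist s (φ j l x) ≤ D + 1 := by
          intro x hx
          rw [Finset.mem_filter, hfin.mem_toFinset] at hx
          obtain ⟨⟨-, hxA, hxS⟩, hxe⟩ := hx
          have h1 := htd x hxA
          simp only [Prod.mk.injEq] at hxe
          rw [hxe.1.1, hxe.1.2, hxe.2] at h1
          exact ⟨hxA, hxS, h1⟩
        -- Points with the same label and target lie within 2(D + 1) of each other, since `φ j l` is
        -- an isometry. Moving `x₀` to o makes the bound `K` independent of where they are.
        rw [← Finset.card_image_of_injective _ (γ x₀)⁻¹.injective]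
        refine hK _ ?_ ?_
        · intro y hy
          obtain ⟨x, hx, rfl⟩ := Finset.mem_image.1 hy
          rw [dist_inv_apply, hγ x₀ (hmem x₀ hx₀).1, ← (φ j l).dist_eq]
          have := dist_triangle_left (φ j l x) (φ j l x₀) s
          linarith [(hmem x hx).2.2, (hmem x₀ hx₀).2.2]
        · intro y hy z hz hyz
          obtain ⟨x, hx, rfl⟩ := Finset.mem_image.1 hy
          obtain ⟨x', hx', rfl⟩ := Finset.mem_image.1 hz
          rw [IsometryEquiv.dist_eq]
          exact hsep x (hmem x hx).2.1 x' (hmem x' hx').2.1 fun e => hyz (by rw [e]))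
    rw [hfin.encard_eq_coe_toFinset_card, hfinT.encard_eq_coe_toFinset_card]
    rw [Finset.card_product, Finset.card_product, Finset.card_range, Finset.card_univ,
      Fintype.card_bool, ← mul_assoc] at hcard
    exact_mod_cast hcard
  have hshift := (tendsto_add_atTop_nat (D + 2)).eventually hTcount
  filter_upwards [hshift, eventually_mul_exp_le (K * 2 * (D + 2)) (D + 2)
    (EReal.coe_lt_coe_iff.1 hαβ)] with n h1 h2
  have h3 : (((Metric.ball o (n : ℝ) ∩ (isomOrbit o A ∩ S)).encard : ℕ∞) : ENNReal) ≤
      ((K * (2 * (n + (D + 2))) : ℕ) : ENNReal) *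
        ((Metric.ball o ((n + (D + 2) : ℕ) : ℝ) ∩ T).encard : ℕ∞) := by
    exact_mod_cast hbound n
  refine (h3.trans (mul_le_mul_right h1 _)).trans ?_
  rw [← ENNReal.ofReal_natCast, ← ENNReal.ofReal_mul (Nat.cast_nonneg _)]
  refine ENNReal.ofReal_le_ofReal (le_trans (mul_le_mul_of_nonneg_right ?_ (Real.exp_pos _).le) h2)
  have h5 : K * (2 * (n + (D + 2))) ≤ K * 2 * (D + 2) * (n + 1) := by
    rw [mul_assoc, mul_assoc]
    refine Nat.mul_le_mul_left K (Nat.mul_le_mul_left 2 ?_)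
    nlinarith
  exact_mod_cast h5

end Entropy

/-! ### From two limit points to the theorem -/

theorem exists_long_pair_of_limitSet_nontrivial {X : Type*} [MetricSpace X] {o : X}
    {hX : IsGromovHyperbolic o} {A : Set (X ≃ᵢ X)} (hA : (limitSet o hX A).Nontrivial) :
    ∃ C : ℝ, 0 ≤ C ∧ ∀ L : ℝ, ∃ p ∈ A, ∃ q ∈ A,
      gromovProduct o (p o) (q o) ≤ C ∧ L ≤ dist (p o) o ∧ L ≤ dist (q o) o := by
  obtain ⟨_, ⟨x, hxA, rfl⟩, _, ⟨y, hyA, rfl⟩, hne⟩ := hA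
  have hasym : ¬ GromovAsymptotic o x.1 y.1 := fun h => hne (Quotient.sound h)
  unfold GromovAsymptotic at hasym
  rw [tendsto_atTop_atTop] at hasym
  push Not at hasym
  -- `C` is fixed before the length `L`, which is later chosen in terms of it.
  obtain ⟨C, hC⟩ := hasym
  have hlong : ∀ (z : GromovSequence o) (L : ℝ), ∃ N, ∀ n ≥ N, L ≤ dist (z.1 n) o := by
    intro z L
    obtain ⟨⟨a, b⟩, hab⟩ := tendsto_atTop_atTop.1 z.2 L
    refine ⟨max a b, fun n hn => ?_⟩
    have := hab (n, n) ⟨(le_max_left a b).trans hn, (le_max_right a b).trans hn⟩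
    rwa [gromovProduct_self] at this
  refine ⟨max C 0, le_max_right _ _, fun L => ?_⟩
  obtain ⟨N, hN⟩ := hlong x L
  obtain ⟨M, hM⟩ := hlong y L
  obtain ⟨⟨a, b⟩, ⟨ha, hb⟩, hab⟩ := hC (N, M)
  obtain ⟨p, hp, hpx⟩ := hxA a
  obtain ⟨q, hq, hqy⟩ := hyA b
  simp only at hpx hqy
  refine ⟨p, hp, q, hq, ?_, ?_, ?_⟩
  · rw [hpx, hqy]
    exact hab.le.trans (le_max_left _ _)
  · rw [hpx]
    exact hN a ha
  · rw [hqy]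
    exact hM b hb

theorem mainTheorem2 {X : Type*} [MetricSpace X] [ProperSpace X] (o : X)
    (hX : IsGromovHyperbolic o) (hcpt : CompactSpace (GromovBoundary o hX))
    (Γ : Subsemigroup (X ≃ᵢ X))
    (hΓ : (limitSet o hX (Γ : Set (X ≃ᵢ X))).Nontrivial) :
    ∃ Γ' : Subsemigroup (X ≃ᵢ X), Γ' ≤ Γ ∧ (Γ' : Set (X ≃ᵢ X)).Nonempty ∧
      IsContracting o (Γ' : Set (X ≃ᵢ X)) ∧
      isomEntropy o (Γ' : Set (X ≃ᵢ X)) = isomEntropy o (Γ : Set (X ≃ᵢ X)) := by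
  obtain ⟨C, hC, hpair⟩ := exists_long_pair_of_limitSet_nontrivial hΓ
  obtain ⟨δ, hδ0, hδ⟩ := id hX
  obtain ⟨p, hp, q, hq, hpq, hpL, hqL⟩ := hpair (20 * C + 100 * δ + 21)
  -- Stated for every pair, because p and q exchange roles when the part avoiding q carries the
  -- entropy.
  have key : ∀ p ∈ Γ, ∀ q ∈ Γ, gromovProduct o (p o) (q o) ≤ C →
      20 * C + 100 * δ + 21 ≤ dist (p o) o → 20 * C + 100 * δ + 21 ≤ dist (q o) o →
      isomEntropy o (Γ : Set (X ≃ᵢ X)) ≤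
        isomEntropy o {γ | γ ∈ Γ ∧ gromovProduct o (γ⁻¹ o) (p o) ≤ C + δ} →
      ∃ Γ' : Subsemigroup (X ≃ᵢ X), Γ' ≤ Γ ∧ (Γ' : Set (X ≃ᵢ X)).Nonempty ∧
        IsContracting o (Γ' : Set (X ≃ᵢ X)) ∧
        isomEntropy o (Γ' : Set (X ≃ᵢ X)) = isomEntropy o (Γ : Set (X ≃ᵢ X)) := by
    intro p hp q hq hpq hpL hqL hent
    obtain ⟨Γ', hle, hne, hcontr, D, u, v, w, hlab⟩ :=
      exists_contracting_subsemigroup hδ hδ0 hp hq hC hpq (by linarith) hpL hqL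
    refine ⟨Γ', hle, hne, hcontr, le_antisymm (partEntropy_mono (image_mono hle))
      (hent.trans (isomEntropy_le_of_labels D
        (fun i k => (if i then v else w) * u ^ k) fun γ hγ => ?_))⟩
    obtain ⟨γ', hγ', hd, k, hk, hvw⟩ := hlab γ hγ.1 hγ.2
    refine ⟨γ', hγ', hd, ?_⟩
    rcases hvw with hv | hw
    · exact ⟨true, k, hk, by simpa using hv⟩
    · exact ⟨false, k, hk, by simpa using hw⟩
  have hcover : isomOrbit o (Γ : Set (X ≃ᵢ X)) ⊆
      isomOrbit o {γ | γ ∈ Γ ∧ gromovProduct o (γ⁻¹ o) (p o) ≤ C + δ} ∪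
        isomOrbit o {γ | γ ∈ Γ ∧ gromovProduct o (γ⁻¹ o) (q o) ≤ C + δ} := by
    rintro _ ⟨γ, hγ, rfl⟩
    have h1 := hδ (p o) (γ⁻¹ o) (q o)
    rcases min_le_iff.1 (by linarith : min (gromovProduct o (p o) (γ⁻¹ o))
      (gromovProduct o (γ⁻¹ o) (q o)) ≤ C + δ) with h2 | h2
    · exact Or.inl ⟨γ, ⟨hγ, by rwa [gromovProduct_comm]⟩, rfl⟩
    · exact Or.inr ⟨γ, ⟨hγ, h2⟩, rfl⟩
  rcases le_max_iff.1 ((partEntropy_mono hcover).trans (partEntropy_union_le o _ _)) with h | h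
  · exact key p hp q hq hpq hpL hqL h
  · exact key q hq p hp (by rwa [gromovProduct_comm]) hqL hpL h
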